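/- Let $G$ be a finite tree with $p\ge 2$ vertices $v_1,\dots,v_p$, all of whose edges have the same length $\ell>0$. Orient the edges arbitrarily and identify each edge $e_j$ with $[0,\ell]$, where $x=0$ is its initial and $x=\ell$ its terminal vertex; $e_j$ is called outgoing from its initial vertex and incoming to its terminal vertex. Given $b_1,\dots,b_p\in\mathbb R$, the Robin problem with zero potential consists of the equations $$-y_j''=\lambda y_j\quad\text{on } e_j=[0,\ell],\qquad j=1,\dots,p-1,$$ together with, at each vertex $v_i$, the requirement that the functions on all edges at $v_i$ have a common value there, denoted $y(v_i)$, and the Robin–Kirchhoff condition $$\sum_{e_j\text{ incoming to }v_i}y_j'(\ell)+b_i\,y(v_i)=\sum_{e_k\text{ outgoing from }v_i}y_k'(0).$$ A real number $\lambda$ is an eigenvalue if this problem has a solution $(y_j)$ that is not identically zero. There is a sequence $\{\lambda_k^{(1)}\}_{k=0}^\infty$ of eigenvalues of the Robin problem with $\sqrt{\lambda_k^{(1)}}=\pi k/\ell+o(1)$ as $k\to\infty$; any two such sequences coincide for all sufficiently large $k$; and every such sequence satisfies $$\sqrt{\lambda_k^{(1)}}=\frac{\pi k}{\ell}+\frac{\sum_{i=1}^p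 b_i}{\pi(p-1)}\cdot\frac1k+o\!\left(\frac1k\right)\qquad\text{as }k\to\infty .$$ -/

import Mathlib

open Filter Asymptotics
open scoped Real

/-- An orientation of a simple graph: each edge `e` is given an initial vertex `tail e`
and a terminal vertex `head e`, which are the two ends of `e`. The edge is parametrized by
`[0, ℓ]`, with `x = 0` at `tail e` and `x = ℓ` at `head e`; it is outgoing from `tail e` and
incoming to `head e`. -/
structure EdgeOrientation {V : Type*} (G : SimpleGraph V) where
  tail : G.edgeSet → V
  head : G.edgeSet → V
  ends : ∀ e : G.edgeSet, s(tail e, head e) = (e : Sym2 V)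

/-- The family `y e : [0, ℓ] → ℝ`, indexed by the edges, solves the Robin spectral problem with
zero potential, spectral parameter `lam` and Robin coefficients `b` on the graph `G` all of whose
edges have length `ℓ`. Here `dy e` is the derivative of `y e` on `[0, ℓ]` (one-sided at the end
points), and `u v` is the common value at the vertex `v` of the functions on the edges at `v`. -/
structure IsRobinSolution {V : Type*} [DecidableEq V] {G : SimpleGraph V} [Fintype G.edgeSet]
    (O : EdgeOrientation G) (ℓ : ℝ) (b : V → ℝ) (lam : ℝ)
    (y dy : G.edgeSet → ℝ → ℝ) (u : V → ℝ) : Prop where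
  /-- `dy e` is the derivative of `y e` on `[0, ℓ]`. -/
  hasDeriv : ∀ e, ∀ x ∈ Set.Icc 0 ℓ, HasDerivWithinAt (y e) (dy e x) (Set.Icc 0 ℓ) x
  /-- The equation `-y'' = lam * y` on each edge. -/
  equation : ∀ e, ∀ x ∈ Set.Icc 0 ℓ,
    HasDerivWithinAt (dy e) (-(lam * y e x)) (Set.Icc 0 ℓ) x
  /-- Continuity at the vertices: edges outgoing from `v` have value `u v` at `x = 0`. -/
  continuous_tail : ∀ e, y e 0 = u (O.tail e)
  /-- Continuity at the vertices: edges incoming to `v` have value `u v` at `x = ℓ`. -/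
  continuous_head : ∀ e, y e ℓ = u (O.head e)
  /-- The Robin–Kirchhoff condition at each vertex. At a pendant vertex it reads
  `y'(ℓ) + b y(ℓ) = 0` for an incoming edge and `-y'(0) + b y(0) = 0` for an outgoing one. -/
  robin : ∀ v, (∑ e with O.head e = v, dy e ℓ) + b v * u v = ∑ e with O.tail e = v, dy e 0

/-- The real number `lam` is an eigenvalue of the Robin problem: there is a solution
that does not vanish identically on the graph. -/
def IsRobinEigenvalue {V : Type*} [DecidableEq V] {G : SimpleGraph V} [Fintype G.edgeSet]
    (O : EdgeOrientation G) (ℓ : ℝ) (b : V → ℝ) (lam : ℝ) : Prop :=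
  ∃ (y dy : G.edgeSet → ℝ → ℝ) (u : V → ℝ), IsRobinSolution O ℓ b lam y dy u ∧
    ∃ e, ∃ x ∈ Set.Icc 0 ℓ, y e x ≠ 0

/-- `lam 0, lam 1, …` is a sequence `λ_k^{(1)}`: a sequence of eigenvalues of the Robin problem
with `√(lam k) = π k / ℓ + o(1)` as `k → ∞`. (Only finitely many `lam k` can be negative, so the
value of `Real.sqrt` at negative numbers plays no role.) -/
def IsFirstRobinSequence {V : Type*} [DecidableEq V] {G : SimpleGraph V} [Fintype G.edgeSet]
    (O : EdgeOrientation G) (ℓ : ℝ) (b : V → ℝ) (lam : ℕ → ℝ) : Prop :=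
  (∀ k, IsRobinEigenvalue O ℓ b (lam k)) ∧
    (fun k : ℕ => √(lam k) - π * k / ℓ) =o[atTop] fun _ => (1 : ℝ)

/-! With `s = √lam > 0`, each edge function is a combination of `cos (s x)` and `sin (s x)`, so the
eigenvalue problem becomes a finite linear system for vertex values `u` and scaled slopes `c`. Put
`s ℓ = π k + δ` and `η = 1 / (π k)`. A tree is bipartite, so a sign change on vertices removes the
factor `(-1) ^ k`; the system then depends only on `cos δ`, `sin δ`, `1 / s` and is a small
perturbation of the one with parameters `(1, 0, 0)`.

The unperturbed kernel is spanned by `u = 1`, `c = 0`, because a tree has no circulations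
(`EdgeOrientation.circulation_eq_zero`); the one compatibility condition is that the vertex data sum
to zero. Bordering (a Lyapunov–Schmidt reduction) makes the system invertible, and `s ^ 2` is an
eigenvalue iff the border variable, a C¹ function of `(η, δ)`, vanishes. Summing the vertex
equations (`card_mul_borderedSolution`) shows that its linear part is proportional to `(p - 1) δ - ℓ
(∑ b) η`. The implicit function theorem gives a single curve `δ = ψ η` with `ψ' 0 = ℓ (∑ b) / (p -
1)`, which yields existence, eventual uniqueness and the asymptotics. -/

/-! ### Analytic preliminaries. -/

/-- A two-variable implicit function theorem with scalar values. -/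
theorem exists_implicit_of_hasStrictFDerivAt {f : ℝ × ℝ → ℝ} {a d : ℝ} (hd : d ≠ 0)
    (hf : HasStrictFDerivAt f
      (a • ContinuousLinearMap.fst ℝ ℝ ℝ + d • ContinuousLinearMap.snd ℝ ℝ ℝ) 0)
    (h0 : f 0 = 0) :
    ∃ ψ : ℝ → ℝ, ψ 0 = 0 ∧ HasDerivAt ψ (-a / d) 0 ∧
      ∀ᶠ v in nhds (0 : ℝ × ℝ), f v = 0 ↔ ψ v.1 = v.2 := by
  set f' := a • ContinuousLinearMap.fst ℝ ℝ ℝ + d • ContinuousLinearMap.snd ℝ ℝ ℝ with hf'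
  have hinr : f' ∘L .inr ℝ ℝ ℝ =
      ((ContinuousLinearEquiv.unitsEquivAut ℝ (Units.mk0 d hd) : ℝ ≃L[ℝ] ℝ) : ℝ →L[ℝ] ℝ) := by
    ext; simp [hf']
  have hinv : (f' ∘L .inr ℝ ℝ ℝ).IsInvertible := ⟨_, hinr.symm⟩
  have hiff := hf.eventually_apply_eq_iff_implicitFunctionOfProdDomain hinv
  rw [h0] at hiff
  refine ⟨hf.implicitFunctionOfProdDomain hinv, hiff.self_of_nhds.1 h0, ?_, hiff⟩
  have h := (hf.hasStrictFDerivAt_implicitFunctionOfProdDomain hinv).hasFDerivAt.hasDerivAt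
  rw [hinr, ContinuousLinearMap.inverse_equiv] at h
  have ha : f' (1, 0) = a := by simp [hf']
  refine h.congr_deriv ?_
  simp [ha, div_eq_mul_inv]

/-- A solution of the harmonic oscillator equation on `[0, ℓ]` is a combination of
`cos (s x)` and `sin (s x)`. -/
theorem eq_cos_add_sin_of_hasDerivWithinAt {ℓ s : ℝ} (hℓ : 0 < ℓ) (hs : s ≠ 0) {y dy : ℝ → ℝ}
    (h1 : ∀ x ∈ Set.Icc 0 ℓ, HasDerivWithinAt y (dy x) (Set.Icc 0 ℓ) x)
    (h2 : ∀ x ∈ Set.Icc 0 ℓ, HasDerivWithinAt dy (-(s ^ 2 * y x)) (Set.Icc 0 ℓ) x)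
    {x : ℝ} (hx : x ∈ Set.Icc 0 ℓ) :
    y x = y 0 * Real.cos (s * x) + dy 0 / s * Real.sin (s * x) ∧
      dy x = s * (dy 0 / s * Real.cos (s * x) - y 0 * Real.sin (s * x)) := by
  have hcos : ∀ x, HasDerivAt (fun x => Real.cos (s * x)) (-Real.sin (s * x) * s) x := fun x => by
    simpa using ((hasDerivAt_id x).const_mul s).cos
  have hsin : ∀ x, HasDerivAt (fun x => Real.sin (s * x)) (Real.cos (s * x) * s) x := fun x => by
    simpa using ((hasDerivAt_id x).const_mul s).sin
  have const : ∀ g : ℝ → ℝ, (∀ x ∈ Set.Icc 0 ℓ, HasDerivWithinAt g 0 (Set.Icc 0 ℓ) x) →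
      g x = g 0 := fun g hg =>
    (convex_Icc 0 ℓ).is_const_of_fderivWithin_eq_zero (𝕜 := ℝ)
      (fun z hz => (hg z hz).differentiableWithinAt)
      (fun z hz => by
        have := (hg z hz).hasFDerivWithinAt.fderivWithin (uniqueDiffOn_Icc hℓ z hz)
        rw [this]; ext; simp) hx ⟨le_rfl, hx.1.trans hx.2⟩
  -- The vector `(y, dy / s)` rotated by the angle `s x` is constant; `hA` and `hB` are its two
  -- coordinates.
  have hA := const (fun x => y x * Real.cos (s * x) - dy x / s * Real.sin (s * x)) fun z hz => by
    refine HasDerivWithinAt.congr_deriv (((h1 z hz).mul (hcos z).hasDerivWithinAt).sub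
      (((h2 z hz).div_const s).mul (hsin z).hasDerivWithinAt)) ?_
    field_simp; ring
  have hB := const (fun x => y x * Real.sin (s * x) + dy x / s * Real.cos (s * x)) fun z hz => by
    refine HasDerivWithinAt.congr_deriv (((h1 z hz).mul (hsin z).hasDerivWithinAt).add
      (((h2 z hz).div_const s).mul (hcos z).hasDerivWithinAt)) ?_
    field_simp; ring
  have hsq := Real.sin_sq_add_cos_sq (s * x)
  simp only [mul_zero, Real.cos_zero, Real.sin_zero, mul_one, sub_zero, zero_add] at hA hB
  constructor
  · rw [← hA, ← hB]; linear_combination (-y x) * hsq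
  · rw [← hA, ← hB]; field_simp; linear_combination (-dy x) * hsq

/-! ### Signs, coboundaries and circulations on trees. -/

section
variable {V : Type*} {G : SimpleGraph V}

theorem EdgeOrientation.adj (O : EdgeOrientation G) (e : G.edgeSet) :
    G.Adj (O.tail e) (O.head e) := by
  rw [← SimpleGraph.mem_edgeSet, O.ends e]; exact e.2

theorem EdgeOrientation.exists_edge (O : EdgeOrientation G) {v w : V} (h : G.Adj v w) :
    ∃ e, O.tail e = v ∧ O.head e = w ∨ O.tail e = w ∧ O.head e = v :=
  ⟨⟨s(v, w), h⟩, by simpa using O.ends ⟨s(v, w), h⟩⟩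

/-- A vertex function that is constant along edges is constant on a connected graph. -/
theorem EdgeOrientation.eq_of_head_eq_tail (O : EdgeOrientation G) (hG : G.Preconnected)
    {u : V → ℝ} (hu : ∀ e, u (O.head e) = u (O.tail e)) (v w : V) : u v = u w := by
  obtain ⟨p⟩ := hG v w
  induction p with
  | nil => rfl
  | cons h _ ih =>
    rw [← ih]
    obtain ⟨e, ⟨h1, h2⟩ | ⟨h1, h2⟩⟩ := O.exists_edge h
    · rw [← h1, ← h2, hu]
    · rw [← h1, ← h2, hu]

/-- A tree carries a sign function that changes along each edge. -/
theorem EdgeOrientation.exists_sign (O : EdgeOrientation G) (hG : G.IsTree) :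
    ∃ ε : V → ℝ, (∀ v, ε v * ε v = 1) ∧ ∀ e, ε (O.head e) = -ε (O.tail e) := by
  refine ⟨fun v => if hG.coloringTwo v = 0 then 1 else -1, fun v => by dsimp only; split_ifs <;> norm_num,
    fun e => ?_⟩
  have h := hG.coloringTwo.valid (O.adj e)
  dsimp only
  generalize hG.coloringTwo (O.tail e) = i at h ⊢
  generalize hG.coloringTwo (O.head e) = j at h ⊢
  fin_cases i <;> fin_cases j <;> simp_all

variable [Fintype V] [Fintype G.edgeSet]

/-- On a tree every edge function is the coboundary of a vertex function. -/
theorem EdgeOrientation.exists_coboundary_eq (O : EdgeOrientation G) (hG : G.IsTree)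
    (c : G.edgeSet → ℝ) : ∃ u : V → ℝ, ∀ e, u (O.head e) - u (O.tail e) = c e := by
  let d : (V → ℝ) →ₗ[ℝ] (G.edgeSet → ℝ) :=
    LinearMap.funLeft ℝ ℝ O.head - LinearMap.funLeft ℝ ℝ O.tail
  have hker : LinearMap.ker d ≤ Submodule.span ℝ {fun _ => 1} := by
    intro u hu
    obtain ⟨v⟩ := hG.connected.nonempty
    refine Submodule.mem_span_singleton.2 ⟨u v, funext fun w => ?_⟩
    have := O.eq_of_head_eq_tail hG.connected.preconnected
      (fun e => sub_eq_zero.1 (congrFun (LinearMap.mem_ker.1 hu) e)) v w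
    simpa using this
  have h1 : Module.finrank ℝ (LinearMap.ker d) ≤ 1 :=
    (Submodule.finrank_mono hker).trans ((finrank_span_le_card _).trans (by simp))
  have h2 := d.finrank_range_add_finrank_ker
  have h3 := hG.card_edgeFinset
  rw [SimpleGraph.edgeFinset_card] at h3
  have h4 := (LinearMap.range d).finrank_le
  rw [Module.finrank_fintype_fun_eq_card] at h2 h4
  -- Rank–nullity: the kernel consists of constants and a tree has one edge fewer than vertices.
  have hr : LinearMap.range d = ⊤ :=
    Submodule.eq_top_of_finrank_eq (by rw [Module.finrank_fintype_fun_eq_card]; omega)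
  obtain ⟨u, hu⟩ := LinearMap.range_eq_top.1 hr c
  exact ⟨u, fun e => congrFun hu e⟩

variable [DecidableEq V]

theorem sum_sum_filter_eq (h : G.edgeSet → V) (g : V → G.edgeSet → ℝ) :
    ∑ v, ∑ e with h e = v, g v e = ∑ e, g (h e) e := by
  simp_rw [Finset.sum_filter]
  rw [Finset.sum_comm]
  simp

/-- A tree carries no nonzero circulation. -/
theorem EdgeOrientation.circulation_eq_zero (O : EdgeOrientation G) (hG : G.IsTree)
    {c : G.edgeSet → ℝ}
    (hc : ∀ v, ∑ e with O.head e = v, c e = ∑ e with O.tail e = v, c e) : c = 0 := by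
  -- Circulations are orthogonal to coboundaries, and on a tree `c` is itself a coboundary, so `∑ c
  -- e * c e = 0`.
  obtain ⟨u, hu⟩ := O.exists_coboundary_eq hG c
  have h : ∑ v, u v * ∑ e with O.head e = v, c e = ∑ v, u v * ∑ e with O.tail e = v, c e := by
    simp_rw [hc]
  simp_rw [Finset.mul_sum] at h
  rw [sum_sum_filter_eq O.head (fun v e => u v * c e),
    sum_sum_filter_eq O.tail (fun v e => u v * c e), ← sub_eq_zero, ← Finset.sum_sub_distrib] at h
  have h' : ∑ e, c e * c e = 0 := by
    rw [← h]; exact Finset.sum_congr rfl fun e _ => by rw [← hu]; ring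
  funext e
  simpa using (Finset.sum_eq_zero_iff_of_nonneg fun e _ => mul_self_nonneg (c e)).1 h' e (by simp)
end

/-! ### Reduction to a linear system on vertices and edges. -/

section
variable {V : Type*} {G : SimpleGraph V} [Fintype G.edgeSet] [DecidableEq V]

/-- The linear system for the vertex values `u v` and the scaled initial slopes
`c e = (y e)'(0) / √lam` that characterizes Robin eigenfunctions; here `C` and `S` are the cosine
and sine of `ℓ √lam`, and `τ = 1 / √lam`. -/
structure IsVertexEdgeSolution (O : EdgeOrientation G) (b : V → ℝ) (C S τ : ℝ)
    (u : V → ℝ) (c : G.edgeSet → ℝ) : Prop where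
  edge : ∀ e, u (O.head e) = C * u (O.tail e) + S * c e
  vertex : ∀ v, (∑ e with O.head e = v, (C * c e - S * u (O.tail e))) + τ * (b v * u v) =
    ∑ e with O.tail e = v, c e

variable {O : EdgeOrientation G} {b : V → ℝ} {ℓ s : ℝ}

theorem IsRobinSolution.isVertexEdgeSolution (hℓ : 0 < ℓ) (hs : s ≠ 0)
    {y dy : G.edgeSet → ℝ → ℝ} {u : V → ℝ} (h : IsRobinSolution O ℓ b (s ^ 2) y dy u) :
    IsVertexEdgeSolution O b (Real.cos (s * ℓ)) (Real.sin (s * ℓ)) (1 / s) u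
      (fun e => dy e 0 / s) where
  edge e := by
    rw [← h.continuous_head, ← h.continuous_tail,
      (eq_cos_add_sin_of_hasDerivWithinAt hℓ hs (h.hasDeriv e) (h.equation e)
        ⟨hℓ.le, le_rfl⟩).1]
    ring
  vertex v := by
    have hv := congrArg (fun t => t / s) (h.robin v)
    simp only [add_div, Finset.sum_div] at hv
    rw [← hv]
    congr 1
    · refine Finset.sum_congr rfl fun e _ => ?_
      rw [(eq_cos_add_sin_of_hasDerivWithinAt hℓ hs (h.hasDeriv e) (h.equation e)
        ⟨hℓ.le, le_rfl⟩).2, ← h.continuous_tail]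
      field_simp
    · ring

theorem IsVertexEdgeSolution.isRobinSolution (hs : s ≠ 0) {u : V → ℝ} {c : G.edgeSet → ℝ}
    (h : IsVertexEdgeSolution O b (Real.cos (s * ℓ)) (Real.sin (s * ℓ)) (1 / s) u c) :
    IsRobinSolution O ℓ b (s ^ 2)
      (fun e x => u (O.tail e) * Real.cos (s * x) + c e * Real.sin (s * x))
      (fun e x => s * (c e * Real.cos (s * x) - u (O.tail e) * Real.sin (s * x))) u := by
  have hcos : ∀ x, HasDerivAt (fun x => Real.cos (s * x)) (-Real.sin (s * x) * s) x := fun x => by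
    simpa using ((hasDerivAt_id x).const_mul s).cos
  have hsin : ∀ x, HasDerivAt (fun x => Real.sin (s * x)) (Real.cos (s * x) * s) x := fun x => by
    simpa using ((hasDerivAt_id x).const_mul s).sin
  refine ⟨fun e x _ => ?_, fun e x _ => ?_, fun e => ?_, fun e => ?_, fun v => ?_⟩
  · refine HasDerivAt.hasDerivWithinAt (HasDerivAt.congr_deriv
      (((hcos x).const_mul (u (O.tail e))).add ((hsin x).const_mul (c e))) ?_)
    ring
  · refine HasDerivAt.hasDerivWithinAt (HasDerivAt.congr_deriv
      ((((hcos x).const_mul (c e)).sub ((hsin x).const_mul (u (O.tail e)))).const_mul s) ?_)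
    ring
  · simp
  · rw [h.edge e]; ring
  · simp only [mul_zero, Real.cos_zero, Real.sin_zero, mul_one, sub_zero]
    rw [← Finset.mul_sum, ← Finset.mul_sum, ← h.vertex v, mul_add]
    congr 1
    · congr 1; exact Finset.sum_congr rfl fun e _ => by ring
    · field_simp

/-- `s ^ 2` is an eigenvalue as soon as the linear system has a solution which does not vanish at
some initial vertex. -/
theorem IsVertexEdgeSolution.isRobinEigenvalue (hℓ : 0 < ℓ) (hs : s ≠ 0) {u : V → ℝ}
    {c : G.edgeSet → ℝ}
    (h : IsVertexEdgeSolution O b (Real.cos (s * ℓ)) (Real.sin (s * ℓ)) (1 / s) u c)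
    (e : G.edgeSet) (he : u (O.tail e) ≠ 0) : IsRobinEigenvalue O ℓ b (s ^ 2) :=
  ⟨_, _, _, h.isRobinSolution hs, e, 0, ⟨le_rfl, hℓ.le⟩, by simpa using he⟩

theorem IsRobinEigenvalue.exists_isVertexEdgeSolution (hℓ : 0 < ℓ) (hs : s ≠ 0)
    (h : IsRobinEigenvalue O ℓ b (s ^ 2)) :
    ∃ u c, IsVertexEdgeSolution O b (Real.cos (s * ℓ)) (Real.sin (s * ℓ)) (1 / s) u c ∧
      ¬ (u = 0 ∧ c = 0) := by
  obtain ⟨y, dy, u, hy, e, x, hx, hne⟩ := h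
  refine ⟨u, _, hy.isVertexEdgeSolution hℓ hs, fun ⟨hu, hc⟩ => hne ?_⟩
  rw [(eq_cos_add_sin_of_hasDerivWithinAt hℓ hs (hy.hasDeriv e) (hy.equation e) hx).1,
    hy.continuous_tail, hu, congrFun hc e]
  simp

/-- Changing signs along a bipartition turns `C`, `S` into `-C`, `-S`. -/
theorem IsVertexEdgeSolution.neg {C S τ : ℝ} {u : V → ℝ} {c : G.edgeSet → ℝ}
    (h : IsVertexEdgeSolution O b C S τ u c) {ε : V → ℝ}
    (hε : ∀ e, ε (O.head e) = -ε (O.tail e)) :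
    IsVertexEdgeSolution O b (-C) (-S) τ (fun v => ε v * u v)
      (fun e => ε (O.tail e) * c e) where
  edge e := by rw [h.edge, hε]; ring
  vertex v := by
    have hv := congrArg (fun t => ε v * t) (h.vertex v)
    simp only [mul_add, Finset.mul_sum] at hv
    have h2 : ∑ e with O.tail e = v, ε (O.tail e) * c e = ∑ e with O.tail e = v, ε v * c e :=
      Finset.sum_congr rfl fun e he => by rw [(Finset.mem_filter.1 he).2]
    rw [h2, ← hv]
    congr 1
    · refine Finset.sum_congr rfl fun e he => ?_
      rw [← (Finset.mem_filter.1 he).2, hε]; ring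
    · ring

theorem IsVertexEdgeSolution.neg_one_pow {C S τ : ℝ} {u : V → ℝ} {c : G.edgeSet → ℝ}
    (h : IsVertexEdgeSolution O b C S τ u c) {ε : V → ℝ}
    (hε : ∀ e, ε (O.head e) = -ε (O.tail e)) (k : ℕ) :
    IsVertexEdgeSolution O b ((-1) ^ k * C) ((-1) ^ k * S) τ (fun v => ε v ^ k * u v)
      (fun e => ε (O.tail e) ^ k * c e) := by
  induction k with
  | zero => simpa using h
  | succ k ih =>
    have := ih.neg hε
    simpa only [pow_succ', neg_one_mul, neg_mul, one_mul, mul_assoc] using this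

/-- On a tree, eigenvalues near `(π k / ℓ) ^ 2` are described by a system independent of the parity
of `k`. -/
theorem isRobinEigenvalue_iff_isVertexEdgeSolution [Fintype V] (hG : G.IsTree) (hℓ : 0 < ℓ)
    {k : ℕ} {δ : ℝ} (hs : s ≠ 0) (hk : s * ℓ = π * k + δ) (e : G.edgeSet)
    (hinj : ∀ u c, IsVertexEdgeSolution O b (Real.cos δ) (Real.sin δ) (1 / s) u c →
      u (O.tail e) = 0 → u = 0 ∧ c = 0) :
    IsRobinEigenvalue O ℓ b (s ^ 2) ↔
      ∃ u c, IsVertexEdgeSolution O b (Real.cos δ) (Real.sin δ) (1 / s) u c ∧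
        u (O.tail e) = 1 := by
  obtain ⟨ε, hε1, hε⟩ := O.exists_sign hG
  have hε0 : ∀ v, ε v ^ k ≠ 0 := fun v => pow_ne_zero _ fun h => by simpa [h] using hε1 v
  have hc : Real.cos (s * ℓ) = (-1) ^ k * Real.cos δ := by
    rw [hk, add_comm, mul_comm π, Real.cos_add_nat_mul_pi]
  have hn : Real.sin (s * ℓ) = (-1) ^ k * Real.sin δ := by
    rw [hk, add_comm, mul_comm π, Real.sin_add_nat_mul_pi]
  have hsq : ∀ x : ℝ, (-1) ^ k * ((-1) ^ k * x) = x := fun x => by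
    rw [← mul_assoc, ← mul_pow]; simp
  constructor
  · intro h
    obtain ⟨u, c, huc, hne⟩ := h.exists_isVertexEdgeSolution hℓ hs
    have h' := huc.neg_one_pow hε k
    rw [hc, hn, hsq, hsq] at h'
    have hu0 : ε (O.tail e) ^ k * u (O.tail e) ≠ 0 := fun h0 => hne <| by
      obtain ⟨h1, h2⟩ := hinj _ _ h' h0
      exact ⟨funext fun v => (mul_eq_zero.1 (congrFun h1 v)).resolve_left (hε0 _),
        funext fun e => (mul_eq_zero.1 (congrFun h2 e)).resolve_left (hε0 _)⟩
    -- Since `a ≠ 0`, homogeneity allows normalizing the value at `O.tail e` to 1.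
    set a := ε (O.tail e) ^ k * u (O.tail e)
    refine ⟨fun v => a⁻¹ * (ε v ^ k * u v), fun e => a⁻¹ * (ε (O.tail e) ^ k * c e),
      ⟨fun e => ?_, fun v => ?_⟩, inv_mul_cancel₀ hu0⟩
    · rw [h'.edge e]; ring
    · rw [← Finset.mul_sum, ← h'.vertex v, mul_add, Finset.mul_sum]
      congr 1
      · exact Finset.sum_congr rfl fun e _ => by ring
      · ring
  · rintro ⟨u, c, huc, hu⟩
    have h' := huc.neg_one_pow hε k
    rw [← hc, ← hn] at h'
    exact h'.isRobinEigenvalue hℓ hs e (by rw [hu, mul_one]; exact hε0 _)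
end

/-! ### The bordered system. -/

section
variable {V : Type*} {G : SimpleGraph V} [Fintype V] [Fintype G.edgeSet] [DecidableEq V]

/-- The operator of the linear system `IsVertexEdgeSolution`, bordered by a constant column in the
vertex equations and by the evaluation at the vertex `v₀`; its parameter is `(C, S, τ)`. -/
noncomputable def borderedOperator (O : EdgeOrientation G) (b : V → ℝ) (v₀ : V) (q : ℝ × ℝ × ℝ) :
    ((V → ℝ) × (G.edgeSet → ℝ) × ℝ) →L[ℝ] ((G.edgeSet → ℝ) × (V → ℝ) × ℝ) :=
  LinearMap.toContinuousLinearMap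
    { toFun := fun X =>
        (fun e => X.1 (O.head e) - (q.1 * X.1 (O.tail e) + q.2.1 * X.2.1 e),
          fun v => (∑ e with O.head e = v, (q.1 * X.2.1 e - q.2.1 * X.1 (O.tail e))) +
            q.2.2 * (b v * X.1 v) - (∑ e with O.tail e = v, X.2.1 e) + X.2.2,
          X.1 v₀)
      map_add' := fun X Y => by
        refine Prod.ext (funext fun e => ?_) (Prod.ext (funext fun v => ?_) ?_)
        · simp; ring
        · simp only [Prod.fst_add, Prod.snd_add, Pi.add_apply, mul_add, Finset.sum_add_distrib,
            Finset.sum_sub_distrib]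
          ring
        · simp
      map_smul' := fun r X => by
        refine Prod.ext (funext fun e => ?_) (Prod.ext (funext fun v => ?_) ?_)
        · simp; ring
        · simp only [Prod.smul_fst, Prod.smul_snd, Pi.smul_apply, smul_eq_mul, mul_left_comm _ r,
            RingHom.id_apply, ← mul_sub, ← mul_add, ← Finset.mul_sum]
        · simp }

variable (O : EdgeOrientation G) (b : V → ℝ) (v₀ : V)

theorem borderedOperator_apply (q : ℝ × ℝ × ℝ) (X : (V → ℝ) × (G.edgeSet → ℝ) × ℝ) :
    borderedOperator O b v₀ q X =
      (fun e => X.1 (O.head e) - (q.1 * X.1 (O.tail e) + q.2.1 * X.2.1 e),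
        fun v => (∑ e with O.head e = v, (q.1 * X.2.1 e - q.2.1 * X.1 (O.tail e))) +
          q.2.2 * (b v * X.1 v) - (∑ e with O.tail e = v, X.2.1 e) + X.2.2,
        X.1 v₀) := rfl

theorem contDiff_borderedOperator : ContDiff ℝ 1 (borderedOperator O b v₀) := by
  rw [contDiff_clm_apply_iff]
  intro X
  simp only [borderedOperator_apply]
  fun_prop

theorem isVertexEdgeSolution_iff_borderedOperator {C S τ r : ℝ} {u : V → ℝ} {c : G.edgeSet → ℝ} :
    IsVertexEdgeSolution O b C S τ u c ∧ u v₀ = r ↔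
      borderedOperator O b v₀ (C, S, τ) (u, c, 0) = (0, 0, r) := by
  rw [borderedOperator_apply]
  simp only [Prod.mk.injEq, funext_iff, Pi.zero_apply, add_zero, sub_eq_zero]
  exact ⟨fun ⟨h, h'⟩ => ⟨h.edge, h.vertex, h'⟩, fun ⟨h, h', h''⟩ => ⟨⟨h, h'⟩, h''⟩⟩

/-- The edge equations force `u` to be constant and evaluation at `v₀` kills it. In the sum of the
vertex equations each edge cancels, leaving the border variable times the number of vertices; what
remains is a circulation. -/
theorem borderedOperator_injective (hG : G.IsTree) :
    Function.Injective (borderedOperator O b v₀ (1, 0, 0)) := by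
  rw [injective_iff_map_eq_zero]
  rintro ⟨u, c, t⟩ h
  rw [borderedOperator_apply] at h
  simp only [one_mul, zero_mul, add_zero, sub_zero, Prod.mk_eq_zero, funext_iff,
    Pi.zero_apply] at h
  obtain ⟨h1, h2, h3⟩ := h
  have hu : u = 0 := funext fun v => by
    rw [O.eq_of_head_eq_tail hG.connected.preconnected (fun e => sub_eq_zero.1 (h1 e)) v v₀, h3]
    rfl
  have ht : t = 0 := by
    have hs := Finset.sum_congr rfl fun v (_ : v ∈ Finset.univ) => h2 v
    rw [Finset.sum_add_distrib, Finset.sum_sub_distrib, sum_sum_filter_eq O.head (fun _ e => c e),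
      sum_sum_filter_eq O.tail (fun _ e => c e)] at hs
    have : Nonempty V := ⟨v₀⟩
    simpa using hs
  have hc : c = 0 := O.circulation_eq_zero hG fun v => by
    have := h2 v
    rw [ht] at this
    linarith
  simp [hu, hc, ht]

theorem exists_equiv_borderedOperator (hG : G.IsTree) :
    ∃ A : ((V → ℝ) × (G.edgeSet → ℝ) × ℝ) ≃L[ℝ] ((G.edgeSet → ℝ) × (V → ℝ) × ℝ),
      (A : _ →L[ℝ] _) = borderedOperator O b v₀ (1, 0, 0) := by
  have hdim : Module.finrank ℝ ((V → ℝ) × (G.edgeSet → ℝ) × ℝ) =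
      Module.finrank ℝ ((G.edgeSet → ℝ) × (V → ℝ) × ℝ) := by
    simp only [Module.finrank_prod]
    omega
  refine ⟨(LinearEquiv.ofInjectiveOfFinrankEq
    (borderedOperator O b v₀ (1, 0, 0) : _ →ₗ[ℝ] _)
    (borderedOperator_injective O b v₀ hG) hdim).toContinuousLinearEquiv, ?_⟩
  exact ContinuousLinearMap.ext fun _ => rfl

/-- The solution of the bordered system with right-hand side `(0, 0, 1)`. -/
noncomputable def borderedSolution (q : ℝ × ℝ × ℝ) : (V → ℝ) × (G.edgeSet → ℝ) × ℝ :=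
  (borderedOperator O b v₀ q).inverse (0, 0, 1)

/-- Operator inversion is smooth near an invertible operator, and the bordered operator depends
smoothly on `q`. -/
theorem contDiffAt_borderedSolution (hG : G.IsTree) :
    ContDiffAt ℝ 1 (borderedSolution O b v₀) (1, 0, 0) := by
  obtain ⟨A, hA⟩ := exists_equiv_borderedOperator O b v₀ hG
  have h := contDiffAt_map_inverse (𝕜 := ℝ) (n := 1) A
  rw [hA] at h
  exact (h.comp _ (contDiff_borderedOperator O b v₀).contDiffAt).clm_apply contDiffAt_const

theorem eventually_isInvertible_borderedOperator (hG : G.IsTree) :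
    ∀ᶠ q in nhds (1, 0, 0), (borderedOperator O b v₀ q).IsInvertible := by
  obtain ⟨A, hA⟩ := exists_equiv_borderedOperator O b v₀ hG
  have h := A.nhds
  rw [hA] at h
  exact (contDiff_borderedOperator O b v₀).continuous.continuousAt.eventually h

variable {O b v₀}

theorem borderedOperator_borderedSolution {q : ℝ × ℝ × ℝ}
    (hq : (borderedOperator O b v₀ q).IsInvertible) :
    borderedOperator O b v₀ q (borderedSolution O b v₀ q) = (0, 0, 1) :=
  hq.self_apply_inverse _

theorem eq_borderedSolution {q : ℝ × ℝ × ℝ} (hq : (borderedOperator O b v₀ q).IsInvertible)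
    {X : (V → ℝ) × (G.edgeSet → ℝ) × ℝ} (hX : borderedOperator O b v₀ q X = (0, 0, 1)) :
    X = borderedSolution O b v₀ q := by
  rw [borderedSolution, ← hX, hq.inverse_apply_self]

theorem borderedSolution_one_zero_zero (hG : G.IsTree) :
    borderedSolution O b v₀ (1, 0, 0) = (fun _ => 1, 0, 0) :=
  ((eq_borderedSolution (eventually_isInvertible_borderedOperator O b v₀ hG).self_of_nhds <| by
    rw [borderedOperator_apply]
    simp [funext_iff, Prod.ext_iff]).symm)

/-- This turns solvability into one scalar equation: a normalized solution, extended by border value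
0, must be the unique bordered solution. -/
theorem exists_isVertexEdgeSolution_iff {C S τ : ℝ}
    (hq : (borderedOperator O b v₀ (C, S, τ)).IsInvertible) :
    (∃ u c, IsVertexEdgeSolution O b C S τ u c ∧ u v₀ = 1) ↔
      (borderedSolution O b v₀ (C, S, τ)).2.2 = 0 := by
  constructor
  · rintro ⟨u, c, h⟩
    rw [← eq_borderedSolution hq ((isVertexEdgeSolution_iff_borderedOperator O b v₀).1 h)]
  · intro h
    have h' := borderedOperator_borderedSolution hq
    set X := borderedSolution O b v₀ (C, S, τ)
    exact ⟨X.1, X.2.1, (isVertexEdgeSolution_iff_borderedOperator O b v₀).2 (by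
      rw [← h', ← h])⟩

theorem IsVertexEdgeSolution.eq_zero {C S τ : ℝ}
    (hq : (borderedOperator O b v₀ (C, S, τ)).IsInvertible) {u : V → ℝ} {c : G.edgeSet → ℝ}
    (h : IsVertexEdgeSolution O b C S τ u c) (h0 : u v₀ = 0) : u = 0 ∧ c = 0 := by
  have h' := (isVertexEdgeSolution_iff_borderedOperator O b v₀).1 ⟨h, h0⟩
  have := hq.injective (h'.trans (map_zero _).symm)
  simpa using this

/-- Summing the vertex equations expresses the border variable of the bordered solution. -/
theorem card_mul_borderedSolution {C S τ : ℝ}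
    (hq : (borderedOperator O b v₀ (C, S, τ)).IsInvertible) :
    (borderedSolution O b v₀ (C, S, τ)).2.2 = (Fintype.card V : ℝ)⁻¹ *
      ((∑ e, (S * (borderedSolution O b v₀ (C, S, τ)).1 (O.tail e) +
          (1 - C) * (borderedSolution O b v₀ (C, S, τ)).2.1 e)) -
        τ * ∑ v, b v * (borderedSolution O b v₀ (C, S, τ)).1 v) := by
  have h := borderedOperator_borderedSolution hq
  set X := borderedSolution O b v₀ (C, S, τ)
  rw [borderedOperator_apply] at h
  have h2 := Finset.sum_congr rfl fun v (_ : v ∈ Finset.univ) =>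
    congrFun (congrArg (fun Y => Y.2.1) h) v
  simp only [Finset.sum_add_distrib, Finset.sum_sub_distrib] at h2
  rw [sum_sum_filter_eq O.head (fun _ e => C * X.2.1 e),
    sum_sum_filter_eq O.head (fun _ e => S * X.1 (O.tail e)),
    sum_sum_filter_eq O.tail (fun _ e => X.2.1 e), ← Finset.mul_sum, ← Finset.mul_sum,
    ← Finset.mul_sum] at h2
  simp only [Finset.sum_const, Finset.card_univ, nsmul_eq_mul, Pi.zero_apply, mul_zero] at h2
  have : Nonempty V := ⟨v₀⟩
  have hV : (Fintype.card V : ℝ) ≠ 0 := by simp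
  rw [Finset.sum_add_distrib, ← Finset.mul_sum, ← Finset.mul_sum, eq_inv_mul_iff_mul_eq₀ hV]
  linear_combination h2
end

/-! ### Linearization and the eigenvalue curve. -/

/-- The derivative of `h` enters only multiplied by `g x = 0`, so derivatives of the bordered
solution never have to be computed. -/
theorem HasStrictFDerivAt.mul_of_eq_zero {E : Type*} [NormedAddCommGroup E] [NormedSpace ℝ E]
    {g h : E → ℝ} {g' : E →L[ℝ] ℝ} {x : E} (hg : HasStrictFDerivAt g g' x) (hg0 : g x = 0)
    (hh : ContDiffAt ℝ 1 h x) : HasStrictFDerivAt (fun y => g y * h y) (h x • g') x := by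
  refine (hg.mul (hh.hasStrictFDerivAt one_ne_zero)).congr_fderiv ?_
  simp [hg0]

section
variable {V : Type*} {G : SimpleGraph V} [Fintype V] [Fintype G.edgeSet] [DecidableEq V]

/-- The parameters `(C, S, τ)` of the bordered system in terms of `η = 1 / (π k)` and
`δ = ℓ √lam - π k`. -/
noncomputable def systemParameters (ℓ : ℝ) (w : ℝ × ℝ) : ℝ × ℝ × ℝ :=
  (Real.cos w.2, Real.sin w.2, w.1 * (ℓ / (1 + w.1 * w.2)))

theorem systemParameters_zero (ℓ : ℝ) : systemParameters ℓ 0 = (1, 0, 0) := by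
  simp [systemParameters]

theorem contDiffAt_div_one_add (ℓ : ℝ) :
    ContDiffAt ℝ 1 (fun w : ℝ × ℝ => ℓ / (1 + w.1 * w.2)) 0 :=
  contDiffAt_const.div (by fun_prop) (by simp)

theorem contDiffAt_systemParameters (ℓ : ℝ) : ContDiffAt ℝ 1 (systemParameters ℓ) 0 :=
  (Real.contDiff_cos.comp contDiff_snd).contDiffAt.prodMk
    ((Real.contDiff_sin.comp contDiff_snd).contDiffAt.prodMk
      (contDiffAt_fst.mul (contDiffAt_div_one_add ℓ)))

variable (O : EdgeOrientation G) (b : V → ℝ) (v₀ : V)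

/-- The strict derivative at the origin of the border variable. -/
theorem hasStrictFDerivAt_border (hG : G.IsTree) (ℓ : ℝ) :
    HasStrictFDerivAt (fun w => (borderedSolution O b v₀ (systemParameters ℓ w)).2.2)
      ((-((Fintype.card V : ℝ)⁻¹ * (ℓ * ∑ v, b v))) • ContinuousLinearMap.fst ℝ ℝ ℝ +
        ((Fintype.card V : ℝ)⁻¹ * Fintype.card G.edgeSet) • ContinuousLinearMap.snd ℝ ℝ ℝ) 0 := by
  have hX : ContDiffAt ℝ 1 (fun w => borderedSolution O b v₀ (systemParameters ℓ w)) 0 := by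
    have h := contDiffAt_borderedSolution O b v₀ hG
    rw [← systemParameters_zero ℓ] at h
    exact h.comp _ (contDiffAt_systemParameters ℓ)
  have hX0 : borderedSolution O b v₀ (systemParameters ℓ 0) = (fun _ => 1, 0, 0) := by
    rw [systemParameters_zero, borderedSolution_one_zero_zero hG]
  have hu := contDiffAt_pi.1 hX.fst
  have hc := contDiffAt_pi.1 hX.snd.fst
  have hsin : HasStrictFDerivAt (fun w : ℝ × ℝ => Real.sin w.2)
      (ContinuousLinearMap.snd ℝ ℝ ℝ) 0 := by
    simpa using (hasStrictFDerivAt_snd (𝕜 := ℝ) (p := (0 : ℝ × ℝ))).sin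
  have hcos : HasStrictFDerivAt (fun w : ℝ × ℝ => 1 - Real.cos w.2)
      (0 : ℝ × ℝ →L[ℝ] ℝ) 0 := by
    simpa using (hasStrictFDerivAt_snd (𝕜 := ℝ) (p := (0 : ℝ × ℝ))).cos.const_sub 1
  have hτ := (hasStrictFDerivAt_fst (𝕜 := ℝ) (p := (0 : ℝ × ℝ))).mul_of_eq_zero rfl
    (contDiffAt_div_one_add ℓ)
  -- `sin δ`, `1 - cos δ` and `τ` all vanish at the origin, so only the value `(1, 0, 0)` of the
  -- bordered solution there matters.
  have hmain := ((HasStrictFDerivAt.fun_sum (u := Finset.univ) fun e _ =>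
    (hsin.mul_of_eq_zero (by simp) (hu (O.tail e))).add
      (hcos.mul_of_eq_zero (by simp) (hc e))).sub
    (hτ.mul_of_eq_zero (by simp) (ContDiffAt.sum (s := Finset.univ) fun v _ =>
      contDiffAt_const (c := b v).mul (hu v)))).const_mul (Fintype.card V : ℝ)⁻¹
  refine (hmain.congr_fderiv ?_).congr_of_eventuallyEq ?_
  · ext <;> simp [hX0]
    exact Or.inl (by ring)
  · have hev := eventually_isInvertible_borderedOperator O b v₀ hG
    rw [← systemParameters_zero ℓ] at hev
    filter_upwards [(contDiffAt_systemParameters ℓ).continuousAt.eventually hev] with w hw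
    exact (card_mul_borderedSolution hw).symm

/-- Near the points `π k / ℓ`, the square roots of the eigenvalues lie on a curve. -/
theorem exists_curve_isRobinEigenvalue_iff [Nontrivial V] (hG : G.IsTree) {ℓ : ℝ} (hℓ : 0 < ℓ) :
    ∃ ψ : ℝ → ℝ, ψ 0 = 0 ∧
      HasDerivAt ψ (ℓ * (∑ v, b v) / ((Fintype.card V : ℝ) - 1)) 0 ∧
      ∀ᶠ w in nhds (0 : ℝ × ℝ), ∀ (k : ℕ) (s : ℝ), k ≠ 0 → s ≠ 0 → w.1 = 1 / (π * k) →
        s * ℓ = π * k + w.2 → (IsRobinEigenvalue O ℓ b (s ^ 2) ↔ ψ w.1 = w.2) := by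
  have hcard : (Fintype.card G.edgeSet : ℝ) = Fintype.card V - 1 := by
    have h := hG.card_edgeFinset
    rw [SimpleGraph.edgeFinset_card] at h
    rw [← h]; push_cast; ring
  have hV : (1 : ℝ) < Fintype.card V := by exact_mod_cast Fintype.one_lt_card
  have hE : (Fintype.card G.edgeSet : ℝ) ≠ 0 := by rw [hcard]; linarith
  -- Taking `v₀ = O.tail e` ensures that a normalized solution is nonzero on an actual edge.
  obtain ⟨e⟩ : Nonempty G.edgeSet := Fintype.card_pos_iff.1 (Nat.pos_of_ne_zero (by simpa using hE))
  have hd : (Fintype.card V : ℝ)⁻¹ * Fintype.card G.edgeSet ≠ 0 :=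
    mul_ne_zero (inv_ne_zero (by linarith)) hE
  obtain ⟨ψ, h0, hψ, hev⟩ := exists_implicit_of_hasStrictFDerivAt hd
    (hasStrictFDerivAt_border O b (O.tail e) hG ℓ)
    (by rw [systemParameters_zero, borderedSolution_one_zero_zero hG])
  refine ⟨ψ, h0, hψ.congr_deriv ?_, ?_⟩
  · rw [neg_neg, mul_div_mul_left _ _ (inv_ne_zero (by linarith)), hcard]
  have hinv := eventually_isInvertible_borderedOperator O b (O.tail e) hG
  rw [← systemParameters_zero ℓ] at hinv
  filter_upwards [hev, (contDiffAt_systemParameters ℓ).continuousAt.eventually hinv]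
    with w hw hwinv k s hk hs hη hδ
  have hk' : π * k ≠ 0 := mul_ne_zero Real.pi_ne_zero (by exact_mod_cast hk)
  have hq : systemParameters ℓ w = (Real.cos w.2, Real.sin w.2, 1 / s) := by
    have hsum : π * k + w.2 ≠ 0 := hδ ▸ mul_ne_zero hs hℓ.ne'
    have hsum' : 1 + 1 / (π * k) * w.2 ≠ 0 := fun h => hsum (by field_simp at h; simpa using h)
    -- `1 / s = ℓ / (π k + δ)`, with numerator and denominator divided by `π k`.
    have : w.1 * (ℓ / (1 + w.1 * w.2)) = 1 / s := by
      rw [hη, ← mul_div_assoc, div_eq_div_iff hsum' hs]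
      field_simp
      linear_combination hδ
    rw [systemParameters, this]
  rw [hq] at hw hwinv
  rw [← hw, ← exists_isVertexEdgeSolution_iff hwinv]
  exact isRobinEigenvalue_iff_isVertexEdgeSolution hG hℓ hs hδ e fun u c h h0 => h.eq_zero hwinv h0
end

/-! ### Eigenvalue sequences and their asymptotics. -/

theorem tendsto_one_div_pi_mul_atTop :
    Tendsto (fun k : ℕ => 1 / (π * k)) atTop (nhds 0) := by
  have h := (tendsto_const_div_atTop_nhds_zero_nat (1 / π))
  refine h.congr fun k => ?_
  rw [div_div]

section
variable {V : Type*} {G : SimpleGraph V} [Fintype G.edgeSet] [DecidableEq V]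
  {O : EdgeOrientation G} {b : V → ℝ} {ℓ : ℝ} {ψ : ℝ → ℝ}

theorem IsFirstRobinSequence.tendsto (hℓ : 0 < ℓ) {lam : ℕ → ℝ}
    (h : IsFirstRobinSequence O ℓ b lam) :
    Tendsto (fun k : ℕ => √(lam k) * ℓ - π * k) atTop (nhds 0) := by
  have h' := ((isLittleO_one_iff ℝ).1 h.2).mul_const ℓ
  rw [zero_mul] at h'
  refine h'.congr fun k => ?_
  field_simp

/-- A first Robin sequence eventually lies on the eigenvalue curve. -/
theorem IsFirstRobinSequence.eventually_eq (hℓ : 0 < ℓ)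
    (hψ : ∀ᶠ w in nhds (0 : ℝ × ℝ), ∀ (k : ℕ) (s : ℝ), k ≠ 0 → s ≠ 0 → w.1 = 1 / (π * k) →
      s * ℓ = π * k + w.2 → (IsRobinEigenvalue O ℓ b (s ^ 2) ↔ ψ w.1 = w.2))
    {lam : ℕ → ℝ} (h : IsFirstRobinSequence O ℓ b lam) :
    ∀ᶠ k : ℕ in atTop, 0 < √(lam k) ∧ √(lam k) = (π * k + ψ (1 / (π * k))) / ℓ := by
  have ht := tendsto_one_div_pi_mul_atTop.prodMk_nhds (h.tendsto hℓ)
  filter_upwards [ht.eventually hψ, eventually_ge_atTop 1,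
    (h.tendsto hℓ).eventually_const_lt (show (-π : ℝ) < 0 by linarith [Real.pi_pos])]
    with k hk hk1 hpos
  have hk1' : (1 : ℝ) ≤ k := by exact_mod_cast hk1
  -- A zero root would give `δ = -π k ≤ -π`. Positivity also excludes the junk value of `√` at
  -- negative `lam k`.
  have hs : 0 < √(lam k) := by
    refine (Real.sqrt_nonneg _).lt_of_ne fun h0 => ?_
    rw [← h0] at hpos
    nlinarith [Real.pi_pos]
  have := (hk k (√(lam k)) (by omega) hs.ne' rfl (by ring)).1 (by
    rw [Real.sq_sqrt (Real.sqrt_pos.1 hs).le]; exact h.1 k)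
  refine ⟨hs, ?_⟩
  rw [eq_div_iff hℓ.ne']
  linarith

theorem exists_isFirstRobinSequence (hℓ : 0 < ℓ) (h0 : ψ 0 = 0) (hc : ContinuousAt ψ 0)
    (hψ : ∀ᶠ w in nhds (0 : ℝ × ℝ), ∀ (k : ℕ) (s : ℝ), k ≠ 0 → s ≠ 0 → w.1 = 1 / (π * k) →
      s * ℓ = π * k + w.2 → (IsRobinEigenvalue O ℓ b (s ^ 2) ↔ ψ w.1 = w.2)) :
    ∃ lam : ℕ → ℝ, IsFirstRobinSequence O ℓ b lam := by
  have hψ0 : Tendsto (fun k : ℕ => ψ (1 / (π * k))) atTop (nhds 0) := by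
    have := hc.tendsto.comp tendsto_one_div_pi_mul_atTop
    rwa [h0] at this
  let s : ℕ → ℝ := fun k => (π * k + ψ (1 / (π * k))) / ℓ
  have hs : ∀ k, s k * ℓ = π * k + ψ (1 / (π * k)) := fun k => div_mul_cancel₀ _ hℓ.ne'
  have hev : ∀ᶠ k : ℕ in atTop, 0 < s k ∧ IsRobinEigenvalue O ℓ b (s k ^ 2) := by
    filter_upwards [(tendsto_one_div_pi_mul_atTop.prodMk_nhds hψ0).eventually hψ,
      eventually_ge_atTop 1,
      hψ0.eventually_const_lt (show (-π : ℝ) < 0 by linarith [Real.pi_pos])] with k hk hk1 hpos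
    have hk1' : (1 : ℝ) ≤ k := by exact_mod_cast hk1
    have hsk : 0 < s k := div_pos (by nlinarith [Real.pi_pos]) hℓ
    exact ⟨hsk, (hk k (s k) (by omega) hsk.ne' rfl (hs k)).2 rfl⟩
  obtain ⟨K, hK⟩ := eventually_atTop.1 hev
  -- The curve yields eigenvalues only from `K` on; earlier terms repeat the one at `K`.
  refine ⟨fun k => s (max k K) ^ 2, fun k => (hK _ (le_max_right _ _)).2, ?_⟩
  rw [isLittleO_one_iff]
  have := hψ0.div_const ℓ
  rw [zero_div] at this
  refine this.congr' ?_
  filter_upwards [eventually_ge_atTop K] with k hk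
  rw [max_eq_left hk, Real.sqrt_sq (hK k hk).1.le]
  simp only [s]
  ring
end

theorem theorem3p2 {V : Type*} [Fintype V] [DecidableEq V] [Nontrivial V]
    (G : SimpleGraph V) [DecidableRel G.Adj] (hG : G.IsTree)
    (O : EdgeOrientation G) (ℓ : ℝ) (hℓ : 0 < ℓ) (b : V → ℝ) :
    (∃ lam : ℕ → ℝ, IsFirstRobinSequence O ℓ b lam) ∧
    (∀ lam lam' : ℕ → ℝ, IsFirstRobinSequence O ℓ b lam → IsFirstRobinSequence O ℓ b lam' →
      ∀ᶠ k in atTop, lam k = lam' k) ∧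
    (∀ lam : ℕ → ℝ, IsFirstRobinSequence O ℓ b lam →
      (fun k : ℕ => √(lam k) -
        (π * k / ℓ + (∑ v, b v) / (π * ((Fintype.card V : ℝ) - 1)) * (1 / (k : ℝ))))
        =o[atTop] fun k : ℕ => 1 / (k : ℝ)) := by
  obtain ⟨ψ, h0, hder, hψ⟩ := exists_curve_isRobinEigenvalue_iff O b hG hℓ
  refine ⟨exists_isFirstRobinSequence hℓ h0 hder.continuousAt hψ, fun lam lam' h h' => ?_,
    fun lam h => ?_⟩
  · filter_upwards [h.eventually_eq hℓ hψ, h'.eventually_eq hℓ hψ] with k hk hk'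
    rw [← Real.sq_sqrt (Real.sqrt_pos.1 hk.1).le, ← Real.sq_sqrt (Real.sqrt_pos.1 hk'.1).le,
      hk.2, hk'.2]
  · have hV : (1 : ℝ) < Fintype.card V := by exact_mod_cast Fintype.one_lt_card
    have hV' : (Fintype.card V : ℝ) - 1 ≠ 0 := by linarith
    have ho := hder.isLittleO
    simp only [h0, sub_zero, smul_eq_mul] at ho
    -- The expansion `ψ x = ψ' 0 * x + o(x)` at `x = 1 / (π k)`, divided by `ℓ`; this cancels the
    -- `ℓ` in `ψ' 0`.
    have hk := (ho.comp_tendsto tendsto_one_div_pi_mul_atTop).const_mul_left ℓ⁻¹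
    have hO : ((fun x : ℝ => x) ∘ fun k : ℕ => 1 / (π * k)) =O[atTop] fun k : ℕ => 1 / (k : ℝ) := by
      refine ((isBigO_refl (fun k : ℕ => 1 / (k : ℝ)) atTop).const_mul_left π⁻¹).congr_left
        fun k => ?_
      simp [mul_comm]
    refine (hk.trans_isBigO hO).congr' ?_ EventuallyEq.rfl
    filter_upwards [h.eventually_eq hℓ hψ, eventually_ge_atTop 1] with k hk hk1
    have hk0 : (k : ℝ) ≠ 0 := by exact_mod_cast (by omega : k ≠ 0)
    rw [hk.2]
    simp only [Function.comp_apply]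
    field_simp
    ring
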